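/- Let $M=\mathbb{H}^2\times\mathbb{R}$ be the Riemannian product of the hyperbolic plane (of curvature $-1$) and the real line, let $G$ be its group of isometries, and let $\overline{M}=M\cup M(\infty)$ be its Hadamard (geodesic) compactification: $M(\infty)$ is the set of asymptoty classes of unit speed geodesic rays of $M$, $\overline{M}$ carries the cone topology (generated by the open subsets of $M$ and, for a base point $o\in M$, the sets $U(c,r,\varepsilon)$, where $c$ is a geodesic ray issued from $o$ and $r,\varepsilon>0$, which consist of the points $x\in M$ with $d(o,x)>r$ and of the points $x\in M(\infty)$ such that the geodesic from $o$ to $x$ is, at distance $r$ from $o$, at distance less than $\varepsilon$ from $c(r)$), and $G$ acts naturally on $\overline{M}$. A differentiable Hadamard compactification of $M$ is a $C^1$ structure on $\overline{M}$, as a $3$-dimensional manifold with boundary $M(\infty)$, that is compatible with the differentiable structure of $M$ and such that the action map $G\times\overline{M}\to\overline{M}$ is $C^1$. **Proposition.** The space $\mathbb{H}^2\times\mathbb{R}$ admits no differentiable Hadamard compactification. More precisely, whatever Lie group structure $G$ is given (the usual one, or for instance the discrete one, for which a $C^1$ action is an action by $C^1$ diffeomorphisms), and whatever base point $o$ is used,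 there is no $C^1$ structure on $\overline{M}$ with these properties. -/

import Mathlib

open scoped Manifold ContDiff NNReal UpperHalfPlane

/-- The space `ℍ² × ℝ`: the hyperbolic plane (upper half-plane model, curvature `-1`) times the
real line, with the `ℓ²` product distance, i.e. the distance of the Riemannian product. -/
abbrev H2xR : Type := WithLp 2 (ℍ × ℝ)

/-- Unit speed geodesic rays of a metric space. In a Hadamard manifold every geodesic is
minimizing, so that these are the Riemannian unit speed geodesic rays. -/
structure GeodesicRay (X : Type*) [MetricSpace X] where
  toFun : ℝ≥0 → X
  isometry_toFun : Isometry toFun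

namespace GeodesicRay

variable {X : Type*} [MetricSpace X]

/-- Two geodesic rays are asymptotic if they stay at bounded distance from each other. -/
def Asymptotic (c d : GeodesicRay X) : Prop :=
  ∃ C : ℝ, ∀ t : ℝ≥0, dist (c.toFun t) (d.toFun t) ≤ C

instance setoid (X : Type*) [MetricSpace X] : Setoid (GeodesicRay X) where
  r := Asymptotic
  iseqv :=
    { refl := fun _ => ⟨0, fun _ => (dist_self _).le⟩
      symm := fun ⟨C, h⟩ => ⟨C, fun t => by rw [dist_comm]; exact h t⟩
      trans := fun ⟨C, h⟩ ⟨C', h'⟩ =>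
        ⟨C + C', fun t => (dist_triangle _ _ _).trans (add_le_add (h t) (h' t))⟩ }

/-- The image of a geodesic ray under an isometry. -/
def map (g : X ≃ᵢ X) (c : GeodesicRay X) : GeodesicRay X :=
  ⟨g ∘ c.toFun, g.isometry.comp c.isometry_toFun⟩

end GeodesicRay

/-- The Hadamard (geodesic) boundary `X(∞)`: asymptoty classes of geodesic rays. -/
def HadamardBoundary (X : Type*) [MetricSpace X] : Type _ :=
  Quotient (GeodesicRay.setoid X)

namespace HadamardBoundary

variable {X : Type*} [MetricSpace X]

/-- The endpoint `c(∞)` of a geodesic ray. -/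
def endpoint (c : GeodesicRay X) : HadamardBoundary X :=
  Quotient.mk (GeodesicRay.setoid X) c

/-- The action of an isometry on the boundary: `g • c(∞) = (g ∘ c)(∞)`. -/
def map (g : X ≃ᵢ X) : HadamardBoundary X → HadamardBoundary X :=
  Quotient.map (GeodesicRay.map g) fun _ _ ⟨C, h⟩ =>
    ⟨C, fun t => (g.isometry.dist_eq _ _).trans_le (h t)⟩

end HadamardBoundary

/-- The underlying set of the Hadamard compactification is the disjoint union of `X` and `X(∞)`.
The point `o` is the base point used to describe the cone topology below (for a Hadamard space,
that topology does not depend on `o`). -/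
@[nolint unusedArguments]
def HadamardCompactification (X : Type*) [MetricSpace X] (_o : X) : Type _ :=
  X ⊕ HadamardBoundary X

namespace HadamardCompactification

variable {X : Type*} [MetricSpace X] {o : X}

/-- The inclusion of `X`. -/
def ofPoint (o : X) (x : X) : HadamardCompactification X o := Sum.inl x

/-- The inclusion of `X(∞)`. -/
def ofBoundary (o : X) (ξ : HadamardBoundary X) : HadamardCompactification X o := Sum.inr ξ

/-- The basic neighbourhood `U(c, r, ε)` of `c(∞)`, for a geodesic ray `c` issued from `o`. It
consists of the `x ∈ X` at distance more than `r` from `o` such that the geodesic segment from `o`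
to `x` passes, at distance `r` from `o`, at distance less than `ε` from `c r`, and of the endpoints
of the rays issued from `o` that satisfy the same condition. -/
def coneNhd (o : X) (c : GeodesicRay X) (r : ℝ≥0) (ε : ℝ) : Set (HadamardCompactification X o) :=
  ofPoint o '' {x | (r : ℝ) < dist o x ∧
      ∃ z, dist o z = r ∧ dist z x = dist o x - r ∧ dist z (c.toFun r) < ε} ∪
    ofBoundary o '' {ξ | ∃ d : GeodesicRay X, d.toFun 0 = o ∧ HadamardBoundary.endpoint d = ξ ∧
      dist (d.toFun r) (c.toFun r) < ε}

/-- The cone topology: it is generated by the open subsets of `X` and the sets `U(c, r, ε)`. -/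
instance : TopologicalSpace (HadamardCompactification X o) :=
  TopologicalSpace.generateFrom
    ({V | ∃ U : Set X, IsOpen U ∧ V = ofPoint o '' U} ∪
      {V | ∃ (c : GeodesicRay X) (r : ℝ≥0) (ε : ℝ), c.toFun 0 = o ∧ 0 < r ∧ 0 < ε ∧
        V = coneNhd o c r ε})

/-- The isometry group of `X` acts on the Hadamard compactification. -/
instance : MulAction (X ≃ᵢ X) (HadamardCompactification X o) where
  smul g := Sum.map g (HadamardBoundary.map g)
  one_smul := by
    rintro (x | ξ)
    · rfl
    · induction ξ using Quotient.inductionOn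
      rfl
  mul_smul := by
    rintro g h (x | ξ)
    · rfl
    · induction ξ using Quotient.inductionOn
      rfl

end HadamardCompactification

/-- Let `G` be the isometry group of `ℍ² × ℝ`, with a manifold structure (modelled on `I`). An atlas
on the Hadamard compactification of `ℍ² × ℝ` (modelled on the half-space of dimension `3`) is a
differentiable Hadamard compactification if it makes it a `C¹` manifold with boundary, whose
boundary is the Hadamard boundary, if it is compatible with the differentiable structure of
`ℍ² × ℝ`, and if the action of `G` is `C¹`. -/
structure IsDifferentiableHadamardCompactification
    {E : Type*} [NormedAddCommGroup E] [NormedSpace ℝ E] {H : Type*} [TopologicalSpace H]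
    (I : ModelWithCorners ℝ E H)
    [TopologicalSpace (H2xR ≃ᵢ H2xR)] [ChartedSpace H (H2xR ≃ᵢ H2xR)]
    (o : H2xR) [ChartedSpace (EuclideanHalfSpace 3) (HadamardCompactification H2xR o)] :
    Prop where
  /-- The atlas is a `C¹` atlas. -/
  isManifold : IsManifold (𝓡∂ 3) 1 (HadamardCompactification H2xR o)
  /-- The boundary of the manifold is the Hadamard boundary. -/
  boundary_eq : (𝓡∂ 3).boundary (HadamardCompactification H2xR o) =
    Set.range (HadamardCompactification.ofBoundary o)
  /-- On `ℍ² × ℝ`, the atlas defines the usual `C¹` structure: the inclusion (which is injective)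
  is a local `C¹` diffeomorphism. -/
  compatible : IsLocalDiffeomorph (𝓘(ℝ, ℂ).prod 𝓘(ℝ, ℝ)) (𝓡∂ 3) 1
    (fun p : ℍ × ℝ => HadamardCompactification.ofPoint o (WithLp.toLp 2 p))
  /-- The action map `G × M̄ → M̄` is `C¹`. -/
  contMDiff_smul : ContMDiff (I.prod (𝓡∂ 3)) (𝓡∂ 3) 1
    (fun p : (H2xR ≃ᵢ H2xR) × HadamardCompactification H2xR o => p.1 • p.2)

/-! The group `SL(2, ℝ)` acts on the factor ℍ, with `-1` acting trivially. Vertical rays stay at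
constant distance from each other, so they share one endpoint, the upper pole, which the whole group
fixes. For a C¹ action, derivatives at the pole give a 3-dimensional representation that kills `-1`
and preserves the tangent plane of the boundary.

Such a representation kills the half-turn w (`SLTwo.rep_three_halfTurn`). This is pure algebra, with
no continuity in the group variable, whence the independence from the Lie group structure. Thus w
acts as a C¹ involution tangent to the identity at the pole, hence trivially near it
(`eventually_fixed_of_involutive`). But w fixes a single point of ℍ, and every vertical ray
converges to the pole: contradiction. -/

open Matrix Filter Topology
open scoped MatrixGroups

/-! ### Representations of `SL(2, ℝ)` in dimension at most three -/

namespace SLTwo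

/-- The half-turn. -/
def halfTurn : SL(2, ℝ) := ⟨!![0, -1; 1, 0], by simp⟩

/-- The upper unipotent matrices. -/
def upper (s : ℝ) : SL(2, ℝ) := ⟨!![1, s; 0, 1], by simp⟩

/-- A hyperbolic element. -/
noncomputable def hyp : SL(2, ℝ) := ⟨!![2, 0; 0, 1 / 2], by simp⟩

lemma coe_halfTurn : (halfTurn : Matrix (Fin 2) (Fin 2) ℝ) = !![0, -1; 1, 0] := rfl

lemma coe_upper (s : ℝ) : (upper s : Matrix (Fin 2) (Fin 2) ℝ) = !![1, s; 0, 1] := rfl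

lemma coe_hyp : (hyp : Matrix (Fin 2) (Fin 2) ℝ) = !![2, 0; 0, 1 / 2] := rfl

lemma halfTurn_mul_halfTurn : halfTurn * halfTurn = -1 := by
  refine Matrix.SpecialLinearGroup.ext _ _ fun i j => ?_
  simp only [Matrix.SpecialLinearGroup.coe_mul, Matrix.SpecialLinearGroup.coe_neg,
    Matrix.SpecialLinearGroup.coe_one,
    coe_halfTurn]
  fin_cases i <;> fin_cases j <;> norm_num [mul_apply, Fin.sum_univ_two]

lemma hyp_mul_halfTurn_mul_hyp : hyp * halfTurn * hyp = halfTurn := by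
  refine Matrix.SpecialLinearGroup.ext _ _ fun i j => ?_
  simp only [Matrix.SpecialLinearGroup.coe_mul, coe_halfTurn, coe_hyp]
  fin_cases i <;> fin_cases j <;> norm_num [mul_apply, Fin.sum_univ_two]

/-- Conjugation by `hyp * hyp`, which is diag(4, 1/4), multiplies the parameter by 16 = 15 + 1. -/
lemma hyp_mul_upper (s : ℝ) :
    hyp * hyp * upper s = upper (15 * s) * upper s * (hyp * hyp) := by
  refine Matrix.SpecialLinearGroup.ext _ _ fun i j => ?_
  simp only [Matrix.SpecialLinearGroup.coe_mul, coe_upper, coe_hyp]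
  fin_cases i <;> fin_cases j <;> norm_num [mul_apply, Fin.sum_univ_two]
  ring

lemma halfTurn_braid :
    halfTurn * upper 1 * halfTurn = upper (-1) * halfTurn * upper (-1) := by
  refine Matrix.SpecialLinearGroup.ext _ _ fun i j => ?_
  simp only [Matrix.SpecialLinearGroup.coe_mul, coe_upper, coe_halfTurn]
  fin_cases i <;> fin_cases j <;> norm_num [mul_apply, Fin.sum_univ_two]

/-- A homomorphism of `SL(2, ℝ)` that maps the half-turn to an element
commuting with the image of `hyp` kills the half-turn. -/
lemma map_halfTurn_eq_one {N : Type*} [Monoid N] (φ : SL(2, ℝ) →* N)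
    (h : Commute (φ halfTurn) (φ hyp)) : φ halfTurn = 1 := by
  have hu (g : SL(2, ℝ)) : IsUnit (φ g) := (Group.isUnit g).map φ
  -- The half-turn conjugates `hyp` to its inverse; if the images commute, the image of `hyp` is its
  -- own inverse.
  have h1 : φ hyp * φ hyp = 1 := by
    have := congrArg φ hyp_mul_halfTurn_mul_hyp
    rw [map_mul, map_mul, mul_assoc, h.eq, ← mul_assoc] at this
    exact (hu _).mul_right_cancel (by rw [this, one_mul])
  have h2 (s : ℝ) : φ (upper s) = 1 := by
    have := congrArg φ (hyp_mul_upper (s / 15))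
    simp only [map_mul, h1, mul_one, one_mul] at this
    rw [mul_div_cancel₀ s (by norm_num)] at this
    exact ((hu _).mul_right_cancel (by rw [one_mul]; exact this)).symm
  -- With unipotents killed, the braid relation reads w² = w.
  have := congrArg φ halfTurn_braid
  simp only [map_mul, h2, mul_one, one_mul] at this
  exact (hu _).mul_left_cancel (by rw [this, mul_one])

/-- A two-dimensional representation of `SL(2, ℝ)` that kills `-1` kills the half-turn. -/
lemma rep_two_halfTurn (φ : SL(2, ℝ) →* Matrix (Fin 2) (Fin 2) ℝ) (h : φ (-1) = 1) :
    φ halfTurn = 1 := by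
  apply map_halfTurn_eq_one
  have hdet : (φ halfTurn).det = 1 :=
    map_halfTurn_eq_one ((Matrix.detMonoidHom).comp φ) (Commute.all _ _)
  have hsq : φ halfTurn * φ halfTurn = 1 := by rw [← map_mul, halfTurn_mul_halfTurn, h]
  generalize φ halfTurn = A at *
  generalize φ hyp = B
  have e := fun i j => congrFun (congrFun hsq i) j
  have h00 := e 0 0
  have h01 := e 0 1
  have h10 := e 1 0
  have h11 := e 1 1
  simp only [mul_apply, Fin.sum_univ_two, one_apply, det_fin_two] at h00 h01 h10 h11 hdet
  simp at h00 h01 h10 h11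
  -- By Cayley–Hamilton, A² = 1 and det A = 1 give tr(A) A = 2, so A is scalar.
  have ht : (A 0 0 + A 1 1) ≠ 0 := by
    intro h0
    have : A 1 1 = - A 0 0 := by linarith
    rw [this] at hdet
    nlinarith
  have hb : A 0 1 = 0 := by
    refine (mul_eq_zero.1 (?_ : (A 0 0 + A 1 1) * A 0 1 = 0)).resolve_left ht
    linarith
  have hc : A 1 0 = 0 := by
    refine (mul_eq_zero.1 (?_ : (A 0 0 + A 1 1) * A 1 0 = 0)).resolve_left ht
    linarith
  have hd : A 0 0 = A 1 1 := by
    have : (A 0 0 + A 1 1) * (A 0 0 - A 1 1) = 0 := by linarith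
    linarith [(mul_eq_zero.1 this).resolve_left ht]
  have : A = A 1 1 • (1 : Matrix (Fin 2) (Fin 2) ℝ) := by
    ext i j
    fin_cases i <;> fin_cases j <;> simp [hb, hc, hd]
  rw [this]
  exact (Commute.one_left B).smul_left _

/-- A three-dimensional representation of `SL(2, ℝ)` that kills `-1` and preserves a plane kills
the half-turn. -/
lemma rep_three_halfTurn (φ : SL(2, ℝ) →* Matrix (Fin 3) (Fin 3) ℝ) (h : φ (-1) = 1)
    (hP : ∀ g (j : Fin 2), φ g 0 j.succ = 0) : φ halfTurn = 1 := by
  let χ : SL(2, ℝ) →* ℝ :=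
    { toFun := fun g => φ g 0 0
      map_one' := by simp
      map_mul' := fun g k => by
        have h1 := hP g 0
        have h2 := hP g 1
        simp at h1 h2
        simp [mul_apply, Fin.sum_univ_three, h1, h2] }
  let ψ : SL(2, ℝ) →* Matrix (Fin 2) (Fin 2) ℝ :=
    { toFun := fun g => (φ g).submatrix Fin.succ Fin.succ
      map_one' := by
        rw [map_one]
        exact submatrix_one _ (Fin.succ_injective _)
      map_mul' := fun g k => by
        ext i j
        rw [map_mul, submatrix_apply, mul_apply, mul_apply, Fin.sum_univ_succ, hP k, mul_zero,
          zero_add]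
        rfl }
  have hχ : φ halfTurn 0 0 = 1 := map_halfTurn_eq_one χ (Commute.all _ _)
  have hψ : ψ halfTurn = 1 := by
    refine rep_two_halfTurn ψ ?_
    change (φ (-1)).submatrix Fin.succ Fin.succ = 1
    rw [h]
    exact submatrix_one _ (Fin.succ_injective _)
  have hsq : φ halfTurn * φ halfTurn = 1 := by rw [← map_mul, halfTurn_mul_halfTurn, h]
  have hB (i j : Fin 2) : φ halfTurn i.succ j.succ = (1 : Matrix (Fin 2) (Fin 2) ℝ) i j := by
    rw [← hψ]; rfl
  -- The diagonal blocks being trivial, squaring doubles the off-diagonal column, which therefore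
  -- vanishes.
  have hc (i : Fin 2) : φ halfTurn i.succ 0 = 0 := by
    have := congrFun (congrFun hsq i.succ) 0
    rw [mul_apply, Fin.sum_univ_succ, hχ] at this
    simp only [hB, one_apply, ite_mul, one_mul, zero_mul, Finset.sum_ite_eq, Finset.mem_univ,
      if_true, mul_one] at this
    simp at this
    linarith
  ext i j
  refine Fin.cases ?_ (fun i => ?_) i <;> refine Fin.cases ?_ (fun j => ?_) j
  · simpa using hχ
  · rw [hP, one_apply_ne (Fin.succ_ne_zero j).symm]
  · simp [hc]
  · rw [hB]; simp [one_apply]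

end SLTwo

/-! ### Germs of C¹ actions at a boundary fixed point -/

/-- A `C¹` involution germ of a convex set that is tangent to the identity is the identity. -/
lemma eventually_fixed_of_involutive {E : Type*} [NormedAddCommGroup E] [NormedSpace ℝ E]
    {s : Set E} (hs : Convex ℝ s) (hs' : UniqueDiffOn ℝ s) {x : E} (hx : x ∈ s) {f : E → E}
    (hf : ContDiffWithinAt ℝ 1 f s x) (hfx : f x = x) (hfs : Set.MapsTo f s s)
    (hd : fderivWithin ℝ f s x = ContinuousLinearMap.id ℝ E)
    (hff : ∀ᶠ y in 𝓝[s] x, f (f y) = y) : ∀ᶠ y in 𝓝[s] x, f y = y := by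
  have hg : ContDiffWithinAt ℝ 1 (fun y => f y - y) s x := hf.sub contDiffWithinAt_id
  have hder : ∀ᶠ y in 𝓝[s] x,
      HasFDerivWithinAt (fun y => f y - y) (fderivWithin ℝ (fun y => f y - y) s y) s y := by
    have := hg.eventually (by simp)
    rw [Set.insert_eq_of_mem hx] at this
    filter_upwards [this] with y hy using (hy.differentiableWithinAt one_ne_zero).hasFDerivWithinAt
  have hcont : ContinuousWithinAt (fderivWithin ℝ (fun y => f y - y) s) s x :=
    (hg.fderivWithin_right (m := 0) hs' (by simp) hx).continuousWithinAt
  have h0 : fderivWithin ℝ (fun y => f y - y) s x = 0 := by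
    have h : HasFDerivWithinAt f (ContinuousLinearMap.id ℝ E) s x :=
      hd ▸ (hf.differentiableWithinAt one_ne_zero).hasFDerivWithinAt
    have h' := (h.sub (hasFDerivWithinAt_id x s)).fderivWithin (hs' x hx)
    rw [sub_self] at h'
    exact h'
  -- Put g = f - id. Then g (f y) = -g y, so the Lipschitz constant 1 yields 2‖g y‖ ≤ ‖g y‖.
  obtain ⟨t, ht, hlip⟩ := hs.exists_nhdsWithin_lipschitzOnWith_of_hasFDerivWithinAt_of_nnnorm_lt
    hder hcont 1 (by rw [h0]; simp)
  have hft : ∀ᶠ y in 𝓝[s] x, f y ∈ t := by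
    have : Tendsto f (𝓝[s] x) (𝓝[s] x) := by
      have := hf.continuousWithinAt.tendsto_nhdsWithin hfs
      rwa [hfx] at this
    exact this ht
  filter_upwards [hff, hft, ht] with y h1 h2 h3
  have := hlip.dist_le_mul _ h2 _ h3
  simp only [h1, dist_eq_norm, NNReal.coe_one, one_mul] at this
  have h4 : y - f y - (f y - y) = (2 : ℝ) • (y - f y) := by rw [two_smul]; abel
  rw [h4, norm_smul, norm_sub_rev y, Real.norm_two] at this
  have h5 : ‖f y - y‖ = 0 := by linarith [norm_nonneg (f y - y)]
  exact sub_eq_zero.1 (norm_eq_zero.1 h5)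

/-- The derivative at a boundary point of a map of the half-space to itself that fixes this point
preserves the boundary hyperplane. -/
lemma hasFDerivWithinAt_halfSpace_apply_zero {n : ℕ} [NeZero n]
    {f : EuclideanSpace ℝ (Fin n) → EuclideanSpace ℝ (Fin n)}
    {f' : EuclideanSpace ℝ (Fin n) →L[ℝ] EuclideanSpace ℝ (Fin n)}
    {x v : EuclideanSpace ℝ (Fin n)} (hx : x 0 = 0) (hfx : f x = x)
    (hf : ∀ y, 0 ≤ f y 0) (hd : HasFDerivWithinAt f f' {y | 0 ≤ y 0} x) (hv : v 0 = 0) :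
    f' v 0 = 0 := by
  have hline : HasDerivWithinAt (fun s : ℝ => x + s • v) v Set.univ 0 := by
    have := (((hasDerivAt_id (0 : ℝ)).smul_const v).const_add x).hasDerivWithinAt (s := Set.univ)
    rwa [one_smul] at this
  have hd' : HasFDerivWithinAt f f' {y | 0 ≤ y 0} (x + (0 : ℝ) • v) := by simpa using hd
  have h1 := (hd'.comp_hasDerivWithinAt (0 : ℝ) hline (fun s _ => by simp [hx, hv])).hasDerivAt
    univ_mem
  have h2 : HasDerivAt (fun s : ℝ => f (x + s • v) 0) (f' v 0) 0 :=
    (EuclideanSpace.proj (𝕜 := ℝ) (0 : Fin n)).hasFDerivAt.comp_hasDerivAt _ h1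
  -- Along a line in the boundary, the first coordinate of f is nonnegative and vanishes at x: it
  -- has a minimum there.
  refine IsLocalMin.hasDerivAt_eq_zero (Eventually.of_forall fun s => ?_) h2
  simpa [hfx, hx] using hf _

section Germ

variable {M : Type*} [TopologicalSpace M] [ChartedSpace (EuclideanHalfSpace 3) M]

/-- Let `SL(2, ℝ)` act by `C¹` maps on a `3`-manifold with boundary, so that `-1` acts trivially,
and let `p` be a fixed point on the boundary. Then the half-turn is the identity near `p`. -/
theorem eventually_halfTurn_smul_eq [MulAction SL(2, ℝ) M]
    (hC : ∀ g : SL(2, ℝ), ContMDiff (𝓡∂ 3) (𝓡∂ 3) 1 (fun q : M => g • q))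
    (hneg : ∀ q : M, (-1 : SL(2, ℝ)) • q = q) {p : M}
    (hp : (𝓡∂ 3).IsBoundaryPoint p) (hfix : ∀ g : SL(2, ℝ), g • p = p) :
    ∀ᶠ q in 𝓝 p, SLTwo.halfTurn • q = q := by
  set e := extChartAt (𝓡∂ 3) p with he
  set x := e p with hx
  set s : Set (EuclideanSpace ℝ (Fin 3)) := {y | 0 ≤ y 0} with hs
  have hrange : Set.range (𝓡∂ 3) = s := range_modelWithCornersEuclideanHalfSpace 3
  have hx0 : x 0 = 0 := by
    have h : extChartAt (𝓡∂ 3) p p ∈ frontier (Set.range (𝓡∂ 3)) := hp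
    rw [frontier_range_modelWithCornersEuclideanHalfSpace] at h
    exact Eq.symm h
  have hxs : x ∈ s := hx0.ge
  have huniq : UniqueDiffOn ℝ s := hrange ▸ (𝓡∂ 3).uniqueDiffOn
  have hconv : Convex ℝ s := hrange ▸ (𝓡∂ 3).convex_range
  let F : SL(2, ℝ) → EuclideanSpace ℝ (Fin 3) → EuclideanSpace ℝ (Fin 3) :=
    fun g y => e (g • e.symm y)
  have hFC (g) : ContDiffWithinAt ℝ 1 (F g) s x := by
    have := (contMDiffAt_iff.1 ((hC g).contMDiffAt (x := p))).2
    rw [hrange, hfix g] at this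
    exact this
  have hes (y) : e y ∈ s := by
    rw [← hrange]
    exact Set.mem_range_self _
  have hFs (g) : Set.MapsTo (F g) s s := fun y _ => hes _
  have hsymm : e.symm x = p := extChartAt_to_inv p
  have hFx (g) : F g x = x := by
    change e (g • e.symm x) = x
    rw [hsymm, hfix]
  have hsource (g : SL(2, ℝ)) : ∀ᶠ q in 𝓝 p, g • q ∈ e.source := by
    have : Tendsto (fun q => g • q) (𝓝 p) (𝓝 p) := by
      have := (hC g).continuous.tendsto p
      rwa [hfix] at this
    exact this (extChartAt_source_mem_nhds p)
  have htarget : ∀ᶠ y in 𝓝[s] x, y ∈ e.target := hrange ▸ extChartAt_target_mem_nhdsWithin p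
  have hFmul (g h) : F (g * h) =ᶠ[𝓝[s] x] F g ∘ F h := by
    have ht : Tendsto e.symm (𝓝[s] x) (𝓝 p) := by
      have := (continuousAt_extChartAt_symm (I := 𝓡∂ 3) p).tendsto
      rw [← he, ← hx, hsymm] at this
      exact this.mono_left nhdsWithin_le_nhds
    filter_upwards [ht.eventually (hsource h)] with y hy
    simp only [F, Function.comp, e.left_inv hy, mul_smul]
  have hFid (g) (hg : ∀ q : M, g • q = q) : ∀ᶠ y in 𝓝[s] x, F g y = y := by
    filter_upwards [htarget] with y hy
    simp only [F, hg, e.right_inv hy]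
  have hFD (g) : HasFDerivWithinAt (F g) (fderivWithin ℝ (F g) s x) s x :=
    ((hFC g).differentiableWithinAt one_ne_zero).hasFDerivWithinAt
  have hDid (g) (hg : ∀ q : M, g • q = q) :
      fderivWithin ℝ (F g) s x = ContinuousLinearMap.id ℝ _ :=
    ((hasFDerivWithinAt_id x s).congr_of_eventuallyEq (hFid g hg) (hFx g)).fderivWithin
      (huniq x hxs)
  let b := (EuclideanSpace.basisFun (Fin 3) ℝ).toBasis
  let φ : SL(2, ℝ) →* Matrix (Fin 3) (Fin 3) ℝ :=
    { toFun := fun g => LinearMap.toMatrix b b (fderivWithin ℝ (F g) s x).toLinearMap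
      map_one' := by
        rw [hDid 1 (one_smul _)]
        exact LinearMap.toMatrix_id b
      map_mul' := fun g h => by
        have h1 : HasFDerivWithinAt (F g) (fderivWithin ℝ (F g) s x) s (F h x) := by
          rw [hFx]; exact hFD g
        have := ((h1.comp x (hFD h) (hFs h)).congr_of_eventuallyEq (hFmul g h)
          (by simp [hFx])).fderivWithin (huniq x hxs)
        rw [this, ← LinearMap.toMatrix_mul]
        rfl }
  have hφ : φ SLTwo.halfTurn = 1 := by
    refine SLTwo.rep_three_halfTurn φ ?_ fun g j => ?_
    · change LinearMap.toMatrix b b (fderivWithin ℝ (F (-1)) s x).toLinearMap = 1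
      rw [hDid _ hneg]
      exact LinearMap.toMatrix_id b
    · change LinearMap.toMatrix b b (fderivWithin ℝ (F g) s x).toLinearMap 0 j.succ = 0
      rw [LinearMap.toMatrix_apply]
      exact hasFDerivWithinAt_halfSpace_apply_zero (f := F g) hx0 (hFx g) (fun y => hes _) (hFD g)
        (by simp [b])
  have hD : fderivWithin ℝ (F SLTwo.halfTurn) s x = ContinuousLinearMap.id ℝ _ := by
    apply ContinuousLinearMap.coe_injective
    apply (LinearMap.toMatrix b b).injective
    exact hφ.trans (LinearMap.toMatrix_id b).symm
  have hinv : ∀ᶠ y in 𝓝[s] x, F SLTwo.halfTurn (F SLTwo.halfTurn y) = y := by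
    have := hFmul SLTwo.halfTurn SLTwo.halfTurn
    rw [SLTwo.halfTurn_mul_halfTurn] at this
    filter_upwards [this, hFid _ hneg] with y h1 h2
    exact h1.symm.trans h2
  have hfin := eventually_fixed_of_involutive hconv huniq hxs (hFC _) (hFx _) (hFs _) hD hinv
  have hte : Tendsto e (𝓝 p) (𝓝[s] x) :=
    tendsto_nhdsWithin_iff.2 ⟨continuousAt_extChartAt (I := 𝓡∂ 3) p, Eventually.of_forall hes⟩
  filter_upwards [hte.eventually hfin, hsource SLTwo.halfTurn,
    extChartAt_source_mem_nhds (I := 𝓡∂ 3) p]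
    with q h1 h2 h3
  simp only [F] at h1
  rw [e.left_inv h3] at h1
  exact e.injOn h2 h3 h1

end Germ

/-! ### Vertical rays and the upper pole -/

section Cone

variable {Y : Type*} [MetricSpace Y]

lemma dist_sq_prod_real (x y : WithLp 2 (Y × ℝ)) :
    dist x y ^ 2 = dist x.fst y.fst ^ 2 + (y.snd - x.snd) ^ 2 := by
  rw [WithLp.prod_dist_eq_add (by norm_num)]
  simp only [ENNReal.toReal_ofNat, Real.rpow_two, ← Real.sqrt_eq_rpow]
  rw [Real.sq_sqrt (by positivity), dist_comm x.snd, Real.dist_eq, sq_abs]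

/-- The vertical ray issued from a point of `Y × ℝ`. -/
def verticalRay (x : WithLp 2 (Y × ℝ)) : GeodesicRay (WithLp 2 (Y × ℝ)) where
  toFun t := WithLp.toLp 2 (x.fst, x.snd + t)
  isometry_toFun := Isometry.of_dist_eq fun s t => by
    rw [← sq_eq_sq₀ dist_nonneg dist_nonneg, dist_sq_prod_real, NNReal.dist_eq, sq_abs]
    simp
    ring

lemma verticalRay_zero (x : WithLp 2 (Y × ℝ)) : (verticalRay x).toFun 0 = x := by
  simp only [verticalRay, NNReal.coe_zero, add_zero]
  rfl

lemma verticalRay_fst (x : WithLp 2 (Y × ℝ)) (t : ℝ≥0) :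
    ((verticalRay x).toFun t).fst = x.fst := rfl

lemma verticalRay_snd (x : WithLp 2 (Y × ℝ)) (t : ℝ≥0) :
    ((verticalRay x).toFun t).snd = x.snd + t := rfl

lemma endpoint_verticalRay (x y : WithLp 2 (Y × ℝ)) :
    HadamardBoundary.endpoint (verticalRay x) = HadamardBoundary.endpoint (verticalRay y) := by
  refine Quotient.sound ⟨dist x y, fun t => ?_⟩
  rw [← sq_le_sq₀ dist_nonneg dist_nonneg, dist_sq_prod_real, dist_sq_prod_real]
  simp [verticalRay]

lemma nonpos_of_eventually_mul_le {a r K : ℝ} (h : ∀ t, r ≤ t → t * a ≤ K) : a ≤ 0 := by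
  by_contra! ha
  have h1 := h (max r ((K + 1) / a)) (le_max_left _ _)
  have h2 : (K + 1) / a * a ≤ max r ((K + 1) / a) * a := by
    gcongr
    exact le_max_right _ _
  rw [div_mul_cancel₀ _ ha.ne'] at h2
  linarith

/-- The equality case of the triangle inequality in the Euclidean plane. -/
lemma eq_of_sq_add_sq {a b e α β r q : ℝ} (ha : 0 ≤ a) (hb : 0 ≤ b) (he : 0 ≤ e) (hr : 0 ≤ r)
    (hq : 0 ≤ q) (h1 : a ^ 2 + α ^ 2 = r ^ 2) (h2 : b ^ 2 + β ^ 2 = q ^ 2)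
    (h3 : e ^ 2 + (α + β) ^ 2 = (r + q) ^ 2) (h4 : e ≤ a + b) :
    (r + q) * a = r * e ∧ (r + q) * α = r * (α + β) := by
  have h5 : e ^ 2 ≤ (a + b) ^ 2 := by gcongr
  have h6 : r * q ≤ a * b + α * β := by nlinarith
  -- Equality in Cauchy–Schwarz: (a, α) and (b, β) are proportional, with ratio r : q.
  have h7 : (q * a - r * b) ^ 2 + (q * α - r * β) ^ 2 ≤ 0 := by
    have : (q * a - r * b) ^ 2 + (q * α - r * β) ^ 2 =
        2 * (r * q) * (r * q - (a * b + α * β)) := by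
      linear_combination q ^ 2 * h1 + r ^ 2 * h2
    rw [this]
    exact mul_nonpos_of_nonneg_of_nonpos (by positivity) (by linarith)
  have h8 : q * a = r * b :=
    sub_eq_zero.1 (pow_eq_zero_iff two_ne_zero |>.1
      (le_antisymm (le_trans (le_add_of_nonneg_right (sq_nonneg _)) h7) (sq_nonneg _)))
  have h9 : q * α = r * β :=
    sub_eq_zero.1 (pow_eq_zero_iff two_ne_zero |>.1
      (le_antisymm (le_trans (le_add_of_nonneg_left (sq_nonneg _)) h7) (sq_nonneg _)))
  refine ⟨?_, by linarith⟩
  have h11 : (r * q) ^ 2 = (a * b + α * β) ^ 2 + (a * β - b * α) ^ 2 := by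
    rw [mul_pow, ← h1, ← h2]; ring
  have h12 : a * b + α * β ≤ r * q := by
    have h13 : (a * b + α * β) ^ 2 ≤ (r * q) ^ 2 := by
      rw [h11]; nlinarith [sq_nonneg (a * β - b * α)]
    exact le_of_sq_le_sq h13 (by positivity)
  have h14 : e = a + b := by
    have : e ^ 2 = (a + b) ^ 2 := by nlinarith
    exact (sq_eq_sq₀ he (by positivity)).1 this
  rw [h14]
  linarith

/-- A geodesic ray of `Y × ℝ` that is asymptotic to a vertical ray is vertical. -/
lemma toFun_eq_of_endpoint_eq {d : GeodesicRay (WithLp 2 (Y × ℝ))} {o x : WithLp 2 (Y × ℝ)}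
    (h0 : d.toFun 0 = o)
    (h : HadamardBoundary.endpoint d = HadamardBoundary.endpoint (verticalRay x)) (r : ℝ≥0) :
    d.toFun r = (verticalRay o).toFun r := by
  rw [endpoint_verticalRay x o] at h
  obtain ⟨C, hC⟩ := Quotient.exact h
  -- Both components of a geodesic ray move at constant speed, so the deviation from the vertical at
  -- time r is r/t times that at time t, which is at most C. Let t tend to infinity.
  have key (t : ℝ≥0) (hrt : r ≤ t) :
      (t : ℝ) * dist o.fst (d.toFun r).fst ≤ r * C ∧
      (t : ℝ) * |(d.toFun r).snd - o.snd - r| ≤ r * C := by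
    obtain ⟨q, rfl⟩ := exists_add_of_le hrt
    have e1 := dist_sq_prod_real o (d.toFun r)
    have e2 := dist_sq_prod_real (d.toFun r) (d.toFun (r + q))
    have e3 := dist_sq_prod_real o (d.toFun (r + q))
    have e4 := dist_sq_prod_real (d.toFun (r + q)) ((verticalRay o).toFun (r + q))
    have hC' := hC (r + q)
    rw [← h0, d.isometry_toFun.dist_eq] at e1 e3
    rw [d.isometry_toFun.dist_eq] at e2
    rw [h0] at e1 e3
    simp only [NNReal.dist_eq, sq_abs] at e1 e2 e3
    rw [verticalRay_fst, verticalRay_snd] at e4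
    have hle : dist o.fst (d.toFun (r + q)).fst ≤ C := by
      refine le_trans ((sq_le_sq₀ dist_nonneg dist_nonneg).1 ?_) hC'
      rw [e4, dist_comm]
      exact le_add_of_nonneg_right (sq_nonneg _)
    have hle' : |(d.toFun (r + q)).snd - o.snd - ↑(r + q)| ≤ C := by
      refine le_trans ((sq_le_sq₀ (abs_nonneg _) dist_nonneg).1 ?_) hC'
      rw [e4, sq_abs]
      nlinarith [sq_nonneg (dist (d.toFun (r + q)).fst o.fst)]
    obtain ⟨h1, h2⟩ := eq_of_sq_add_sq (a := dist o.fst (d.toFun r).fst)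
      (b := dist (d.toFun r).fst (d.toFun (r + q)).fst) (e := dist o.fst (d.toFun (r + q)).fst)
      (α := (d.toFun r).snd - o.snd) (β := (d.toFun (r + q)).snd - (d.toFun r).snd)
      (r := r) (q := q) dist_nonneg dist_nonneg dist_nonneg r.2 q.2
      (by rw [← e1]; simp) (by rw [← e2]; simp)
      (by simp only [NNReal.coe_zero, NNReal.coe_add] at e3; linear_combination -e3)
      (dist_triangle _ _ _)
    push_cast at hle' ⊢
    refine ⟨by rw [h1]; gcongr, ?_⟩
    have h3 : ((r : ℝ) + q) * ((d.toFun r).snd - o.snd - r) =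
        r * ((d.toFun (r + q)).snd - o.snd - (r + q)) := by linear_combination h2
    rw [← abs_of_nonneg (show (0 : ℝ) ≤ r + q by positivity), ← abs_mul, h3, abs_mul,
      abs_of_nonneg r.coe_nonneg]
    gcongr
  have k1 : dist o.fst (d.toFun r).fst ≤ 0 :=
    nonpos_of_eventually_mul_le (r := r) fun t ht => (key ⟨t, r.2.trans ht⟩ ht).1
  have k2 : |(d.toFun r).snd - o.snd - r| ≤ 0 :=
    nonpos_of_eventually_mul_le (r := r) fun t ht => (key ⟨t, r.2.trans ht⟩ ht).2
  have k3 : (d.toFun r).snd - o.snd - r = 0 := abs_nonpos_iff.1 k2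
  have k4 := dist_sq_prod_real (d.toFun r) ((verticalRay o).toFun r)
  rw [verticalRay_fst, verticalRay_snd, dist_comm _ o.fst, le_antisymm k1 dist_nonneg,
    show o.snd + r - (d.toFun r).snd = 0 by linarith] at k4
  simpa using k4

/-- The upper pole of the Hadamard compactification of `Y × ℝ`. -/
noncomputable def upperPole (o : WithLp 2 (Y × ℝ)) : HadamardCompactification (WithLp 2 (Y × ℝ)) o :=
  .ofBoundary o (.endpoint (verticalRay o))

/-- The points of the vertical ray issued from the base point converge to the upper pole. -/
lemma tendsto_verticalRay (o : WithLp 2 (Y × ℝ)) :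
    Tendsto (fun t => HadamardCompactification.ofPoint o ((verticalRay o).toFun t)) atTop
      (𝓝 (upperPole o)) := by
  refine TopologicalSpace.tendsto_nhds_generateFrom_iff.2 ?_
  rintro V (⟨U, -, rfl⟩ | ⟨c, r, ε, hc, hr, hε, rfl⟩) hV
  · obtain ⟨x, -, hx⟩ := hV
    cases hx
  · obtain ⟨x, -, hx⟩ | ⟨ξ, ⟨d, hd0, hd, hdε⟩, hξ⟩ := hV
    · cases hx
    · obtain rfl : ξ = .endpoint (verticalRay o) := Sum.inr_injective hξ
      -- The ray d witnessing that the pole lies in the cone is vertical, so its point at time r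
      -- also serves for all later points of the vertical ray.
      rw [toFun_eq_of_endpoint_eq hd0 hd] at hdε
      filter_upwards [eventually_gt_atTop r] with t ht
      have h1 (t : ℝ≥0) : dist o ((verticalRay o).toFun t) = t := by
        have := (verticalRay o).isometry_toFun.dist_eq 0 t
        rw [verticalRay_zero] at this
        simpa [NNReal.dist_eq] using this
      refine Or.inl ⟨_, ⟨by rw [h1]; exact_mod_cast ht, _, h1 r, ?_, hdε⟩, rfl⟩
      rw [h1, (verticalRay o).isometry_toFun.dist_eq, NNReal.dist_eq, abs_sub_comm, abs_of_pos]
      exact sub_pos.2 (by exact_mod_cast ht)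

end Cone

/-! ### The action on `ℍ² × ℝ` and the contradiction -/

/-- The action of `SL(2, ℝ)` on `ℍ² × ℝ` by isometries. -/
noncomputable def slIsometry : SL(2, ℝ) →* (H2xR ≃ᵢ H2xR) where
  toFun g := IsometryEquiv.withLpProdCongr 2 (IsometryEquiv.constSMul g) (IsometryEquiv.refl ℝ)
  map_one' := IsometryEquiv.ext fun x => by
    change WithLp.toLp 2 ((1 : SL(2, ℝ)) • x.fst, x.snd) = x
    rw [one_smul]
    rfl
  map_mul' g h := IsometryEquiv.ext fun x => by
    change WithLp.toLp 2 ((g * h) • x.fst, x.snd) = WithLp.toLp 2 (g • h • x.fst, x.snd)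
    rw [mul_smul]

lemma slIsometry_apply (g : SL(2, ℝ)) (x : H2xR) :
    slIsometry g x = WithLp.toLp 2 (g • x.fst, x.snd) := rfl

lemma slIsometry_neg_one : slIsometry (-1) = 1 := IsometryEquiv.ext fun x => by
  have h : (-1 : SL(2, ℝ)) • x.fst = x.fst := by
    ext1
    simp [UpperHalfPlane.coe_specialLinearGroup_apply]
  rw [slIsometry_apply, h]
  rfl

lemma slIsometry_smul_upperPole (o : H2xR) (g : SL(2, ℝ)) :
    slIsometry g • upperPole o = upperPole o := by
  have : GeodesicRay.map (slIsometry g) (verticalRay o) = verticalRay (slIsometry g o) := rfl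
  change HadamardCompactification.ofBoundary o
    (.endpoint (GeodesicRay.map (slIsometry g) (verticalRay o))) = _
  rw [this, endpoint_verticalRay _ o]
  rfl

/-- The half-turn moves some translate of any point of `ℍ`. -/
lemma exists_halfTurn_smul_upper_smul_ne (z : ℍ) :
    ∃ s : ℝ, SLTwo.halfTurn • SLTwo.upper s • z ≠ SLTwo.upper s • z := by
  by_contra! h
  have hsq (s : ℝ) : ((z : ℂ) + s) * (z + s) = -1 := by
    have hu : ((SLTwo.upper s • z : ℍ) : ℂ) = z + s := by
      simp [UpperHalfPlane.coe_specialLinearGroup_apply, SLTwo.coe_upper]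
    have hz := (SLTwo.upper s • z).ne_zero
    have := congrArg UpperHalfPlane.coe (h s)
    rw [UpperHalfPlane.coe_specialLinearGroup_apply] at this
    simp only [SLTwo.coe_halfTurn] at this
    simp at this
    rw [div_eq_iff hz, hu] at this
    exact this.symm
  -- Subtracting the equations (z + s)² = -1 for s = 0 and s = 1 gives 2z + 1 = 0.
  have him : (2 * (z : ℂ) + 1).im = 0 := by
    have : 2 * (z : ℂ) + 1 = 0 := by
      have h0 := hsq 0
      have h1 := hsq 1
      push_cast at h0 h1
      linear_combination h1 - h0
    rw [this, Complex.zero_im]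
  have := z.im_pos
  simp at him
  linarith

theorem mainTheorem3
    {E : Type*} [NormedAddCommGroup E] [NormedSpace ℝ E] {H : Type*} [TopologicalSpace H]
    (I : ModelWithCorners ℝ E H)
    [TopologicalSpace (H2xR ≃ᵢ H2xR)] [ChartedSpace H (H2xR ≃ᵢ H2xR)]
    [LieGroup I ∞ (H2xR ≃ᵢ H2xR)] (o : H2xR) :
    ¬ ∃ _ : ChartedSpace (EuclideanHalfSpace 3) (HadamardCompactification H2xR o),
      IsDifferentiableHadamardCompactification I o := by
  rintro ⟨_, h⟩
  let : MulAction SL(2, ℝ) (HadamardCompactification H2xR o) :=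
    MulAction.compHom _ slIsometry
  have hsmul (g : SL(2, ℝ)) (q : HadamardCompactification H2xR o) : g • q = slIsometry g • q := rfl
  have hC (g : SL(2, ℝ)) : ContMDiff (𝓡∂ 3) (𝓡∂ 3) 1
      (fun q : HadamardCompactification H2xR o => g • q) :=
    h.contMDiff_smul.comp (contMDiff_const.prodMk contMDiff_id)
  have hpole : (𝓡∂ 3).IsBoundaryPoint (upperPole o) := by
    have : upperPole o ∈ (𝓡∂ 3).boundary (HadamardCompactification H2xR o) := by
      rw [h.boundary_eq]
      exact Set.mem_range_self _
    exact this
  have hnear := eventually_halfTurn_smul_eq hC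
    (fun q => by rw [hsmul, slIsometry_neg_one, one_smul]) hpole (slIsometry_smul_upperPole o)
  -- The half-turn may fix the vertical line through `o`; a translate of that line avoids this, and
  -- it still tends to the pole because `upper s` fixes the pole.
  obtain ⟨s, hs⟩ := exists_halfTurn_smul_upper_smul_ne o.fst
  have htend : Tendsto (fun t => SLTwo.upper s •
      HadamardCompactification.ofPoint o ((verticalRay o).toFun t)) atTop (𝓝 (upperPole o)) := by
    have := ((hC (SLTwo.upper s)).continuous.tendsto (upperPole o)).comp (tendsto_verticalRay o)
    rwa [hsmul, slIsometry_smul_upperPole] at this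
  obtain ⟨t, ht⟩ := (htend.eventually hnear).exists
  exact hs (congrArg WithLp.fst (Sum.inl_injective ht))
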